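/- Let $X$ be a perfect Polish space, i.e. a separable completely metrizable space without isolated points. A perfect set in $X$ is a non-empty closed subset of $X$ without isolated points. A $\sigma$-ideal on $X$ is a family of subsets of $X$ that is hereditary, closed under countable unions and contains all singletons; it fulfills the c.c.c. if every family of pairwise disjoint Borel subsets of $X$ not belonging to it is countable. A $\sigma$-ideal is generated by closed sets if it is the smallest $\sigma$-ideal on $X$ containing some given family of closed subsets of $X$. A set $A\subseteq X$ is perfectly meager ($A\in\mathbf{PM}$) if $A\cap P$ is meager in $P$ for every perfect set $P\subseteq X$. It is countably perfectly meager ($A\in\mathbf{PM}_\sigma$) if for every sequence $(P_n)_{n\in\mathbb N}$ of perfect sets in $X$ there is an $F_\sigma$-set $F$ in $X$ such that $A\subseteq F$ and $F\cap P_n$ is meager in $P_n$ for each $n$. For a countable non-empty family $\mathcal F$ of perfect sets in $X$, let $MGR(\mathcal F)$ be the $\sigma$-ideal of all $A\subseteq X$ such that $A\cap P$ is meager in $P$ for every $P\in\mathcal F$, and let $MGR^*(\mathcal F)$ be the $\sigma$-ideal generated by the closed subsets of $X$ that belong to $MGR(\mathcal F)$. Then: 1. If $\mathcal F$ is a countable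 non-empty family of perfect sets in $X$ such that every non-empty open set $U\subseteq X$ contains a set $P\in\mathcal F$ that is nowhere dense in $X$, then $MGR^*(\mathcal F)$ does not fulfill the c.c.c. 2. The intersection of all $\sigma$-ideals on $X$ that are generated by closed sets and fulfill the c.c.c. is precisely $\mathbf{PM}$. 3. The intersection of all $\sigma$-ideals of the form $MGR^*(\mathcal F)$, where $\mathcal F$ is a countable non-empty family of perfect sets in $X$, that fulfill the c.c.c. is precisely $\mathbf{PM}$. 4. The intersection of all $\sigma$-ideals of the form $MGR^*(\mathcal F)$, where $\mathcal F$ is a countable non-empty family of perfect sets in $X$, that do not fulfill the c.c.c. is precisely $\mathbf{PM}_\sigma$. -/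

import Mathlib

open Set

namespace PerfMeager

section Ideals

variable {X : Type*}

/-- A σ-ideal of subsets of `X`: a family that is hereditary, closed under countable unions
(the empty union included) and contains all singletons. -/
structure IsSigmaIdeal (I : Set (Set X)) : Prop where
  empty_mem : ∅ ∈ I
  mono : ∀ {A B : Set X}, A ⊆ B → B ∈ I → A ∈ I
  iUnion_mem : ∀ A : ℕ → Set X, (∀ n, A n ∈ I) → (⋃ n, A n) ∈ I
  singleton_mem : ∀ x : X, {x} ∈ I

/-- The σ-ideal generated by a family `C`: the intersection of all σ-ideals containing `C`. -/
def sigmaIdealGenerated (C : Set (Set X)) : Set (Set X) :=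
  ⋂₀ {I | IsSigmaIdeal I ∧ C ⊆ I}

theorem isSigmaIdeal_generated (C : Set (Set X)) : IsSigmaIdeal (sigmaIdealGenerated C) where
  empty_mem := fun _ hI => hI.1.empty_mem
  mono := fun h hB I hI => hI.1.mono h (hB I hI)
  iUnion_mem := fun A hA I hI => hI.1.iUnion_mem A fun n => hA n I hI
  singleton_mem := fun x _ hI => hI.1.singleton_mem x

end Ideals

variable {X : Type*} [TopologicalSpace X]

/-- `I` is the σ-ideal generated by some family of closed sets. -/
def IsGeneratedByClosed (I : Set (Set X)) : Prop :=
  ∃ C : Set (Set X), (∀ s ∈ C, IsClosed s) ∧ I = sigmaIdealGenerated C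

/-- `I*`: the σ-ideal generated by the closed sets that belong to `I`. -/
def starIdeal (I : Set (Set X)) : Set (Set X) :=
  sigmaIdealGenerated {s | IsClosed s ∧ s ∈ I}

/-- The countable chain condition: every family of pairwise disjoint Borel sets not in `I`
is countable. -/
def CCC (I : Set (Set X)) : Prop :=
  ∀ D : Set (Set X), (∀ s ∈ D, @MeasurableSet X (borel X) s ∧ s ∉ I) →
    D.PairwiseDisjoint id → D.Countable

/-- A perfect set: non-empty, closed and without isolated points. -/
def IsPerfectSet (P : Set X) : Prop := P.Nonempty ∧ Perfect P

/-- `A ∩ P` is meager in the subspace `P`. -/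
def MeagerIn (A P : Set X) : Prop := IsMeagre ((↑) ⁻¹' A : Set P)

/-- An `F_σ`-set: a countable union of closed sets. -/
def IsFSigma (F : Set X) : Prop := ∃ C : ℕ → Set X, (∀ n, IsClosed (C n)) ∧ F = ⋃ n, C n

/-- A countable non-empty family of perfect sets. -/
structure IsPerfectFamily (F : Set (Set X)) : Prop where
  countable : F.Countable
  nonempty : F.Nonempty
  perfect : ∀ P ∈ F, IsPerfectSet P

/-- `MGR(F)`: the sets `A` such that `A ∩ P` is meager in `P` for every `P ∈ F`. -/
def MGR (F : Set (Set X)) : Set (Set X) := {A | ∀ P ∈ F, MeagerIn A P}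

/-- `MGR*(F)`: the σ-ideal generated by the closed sets that belong to `MGR(F)`. -/
def MGRStar (F : Set (Set X)) : Set (Set X) := starIdeal (MGR F)

variable (X) in
/-- The perfectly meager subsets of `X`. -/
def PM : Set (Set X) := {A | ∀ P : Set X, IsPerfectSet P → MeagerIn A P}

variable (X) in
/-- The countably perfectly meager subsets of `X`. -/
def PMσ : Set (Set X) :=
  {A | ∀ P : ℕ → Set X, (∀ n, IsPerfectSet (P n)) →
    ∃ F : Set X, IsFSigma F ∧ A ⊆ F ∧ ∀ n, MeagerIn F (P n)}

end PerfMeager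

namespace PerfMeager

open Filter Topology

/-! ### σ-ideals generated by closed sets -/

section Ideals

variable {X : Type*}

/-! Everything rests on `not_ccc_of_closed_nowhereDense`: an ideal generated by closed sets fails
the c.c.c. if every open set meeting a fixed C contains a closed N outside the ideal with N in the
closure of C \ N. A tree of open sets accumulating at such N yields continuum many disjoint Borel
sets, and a branch dodging any given countable closed cover keeps each of them outside the ideal.
With C the whole space this is claim 1. For a PM set outside a c.c.c. ideal, take C to be where the
set is locally positive; its meagerness in C supplies the sets N (`mem_of_mem_pm_of_ccc`).
Conversely, MGR*({P}) inherits the c.c.c. from the meager ideal of P, so these ideals already cut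
the intersection down to PM. For claim 4, any sequence of perfect sets extends to a family as in
claim 1, and a closed cover witnessing membership in MGR* is the required F_σ-set. -/

theorem IsSigmaIdeal.union_mem {I : Set (Set X)} (hI : IsSigmaIdeal I) {A B : Set X}
    (hA : A ∈ I) (hB : B ∈ I) : A ∪ B ∈ I := by
  have h := hI.iUnion_mem (fun n => if n = 0 then A else B) (fun n => by split_ifs <;> assumption)
  refine hI.mono ?_ h
  rintro x (hx | hx)
  · exact mem_iUnion.2 ⟨0, by simpa using hx⟩
  · exact mem_iUnion.2 ⟨1, by simpa using hx⟩

theorem IsSigmaIdeal.sUnion_mem {I : Set (Set X)} (hI : IsSigmaIdeal I) {S : Set (Set X)}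
    (hc : S.Countable) (hS : ∀ s ∈ S, s ∈ I) : ⋃₀ S ∈ I := by
  rcases S.eq_empty_or_nonempty with rfl | hne
  · simpa using hI.empty_mem
  · obtain ⟨f, rfl⟩ := hc.exists_eq_range hne
    rw [sUnion_range]
    exact hI.iUnion_mem f fun n => hS _ ⟨n, rfl⟩

theorem IsSigmaIdeal.nonempty_of_notMem {I : Set (Set X)} (hI : IsSigmaIdeal I) {A : Set X}
    (hA : A ∉ I) : A.Nonempty := by
  rw [nonempty_iff_ne_empty]
  rintro rfl
  exact hA hI.empty_mem

theorem subset_sigmaIdealGenerated (C : Set (Set X)) : C ⊆ sigmaIdealGenerated C :=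
  fun _ hs _ hI => hI.2 hs

end Ideals

section Topological

variable {X : Type*} [TopologicalSpace X]

theorem IsGeneratedByClosed.isSigmaIdeal {I : Set (Set X)} (hI : IsGeneratedByClosed I) :
    IsSigmaIdeal I := by
  obtain ⟨C, -, rfl⟩ := hI
  exact isSigmaIdeal_generated C

theorem isGeneratedByClosed_mgrStar (F : Set (Set X)) : IsGeneratedByClosed (MGRStar F) :=
  ⟨_, fun _ hs => hs.1, rfl⟩

/-- The sets with such a cover form a σ-ideal containing the generators, so minimality applies. -/
theorem IsGeneratedByClosed.exists_closed_cover [T1Space X] {I : Set (Set X)}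
    (hI : IsGeneratedByClosed I) {A : Set X} (hA : A ∈ I) :
    ∃ D : ℕ → Set X, (∀ n, IsClosed (D n) ∧ D n ∈ I) ∧ A ⊆ ⋃ n, D n := by
  obtain ⟨C, hC, rfl⟩ := hI
  have hg := isSigmaIdeal_generated C
  refine hA {A | ∃ D : ℕ → Set X,
    (∀ n, IsClosed (D n) ∧ D n ∈ sigmaIdealGenerated C) ∧ A ⊆ ⋃ n, D n} ⟨⟨?_, ?_, ?_, ?_⟩, ?_⟩
  · exact ⟨fun _ => ∅, fun _ => ⟨isClosed_empty, hg.empty_mem⟩, empty_subset _⟩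
  · rintro A B hAB ⟨D, hD, hBD⟩
    exact ⟨D, hD, hAB.trans hBD⟩
  · intro A hA
    choose D hD hAD using hA
    refine ⟨fun n => D n.unpair.1 n.unpair.2, fun n => hD _ _, ?_⟩
    refine iUnion_subset fun n x hx => ?_
    obtain ⟨m, hm⟩ := mem_iUnion.1 (hAD n hx)
    exact mem_iUnion.2 ⟨Nat.pair n m, by simpa using hm⟩
  · intro x
    exact ⟨fun _ => {x}, fun _ => ⟨isClosed_singleton, hg.singleton_mem x⟩,
      subset_iUnion (fun _ : ℕ => {x}) 0⟩
  · intro s hs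
    exact ⟨fun _ => s, fun _ => ⟨hC s hs, subset_sigmaIdealGenerated C hs⟩,
      subset_iUnion (fun _ : ℕ => s) 0⟩

/-! ### Meager subsets of closed sets -/

/-- Nowhere density in P is recorded as `N n ⊆ closure (P \ N n)`, the ambient form used by the
c.c.c. criterion. -/
theorem MeagerIn.exists_closed_cover {A P : Set X} (hP : IsClosed P) (hA : MeagerIn A P) :
    ∃ N : ℕ → Set X, (∀ n, IsClosed (N n) ∧ N n ⊆ closure (P \ N n) ∧ MeagerIn (N n) P) ∧
      A ∩ P ⊆ ⋃ n, N n := by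
  obtain ⟨S, hS, hSc, hAS⟩ := isMeagre_iff_countable_union_isNowhereDense.1 hA
  obtain ⟨t, ht⟩ := (hSc.insert ∅).exists_eq_range (insert_nonempty ∅ S)
  have htn : ∀ n, IsNowhereDense (t n) := by
    intro n
    have : t n ∈ insert ∅ S := ht ▸ mem_range_self n
    rcases this with h | h
    · rw [h]; exact isNowhereDense_empty
    · exact hS _ h
  refine ⟨fun n => (↑) '' closure (t n), fun n => ⟨?_, ?_, ?_⟩, ?_⟩
  · exact hP.isClosedEmbedding_subtypeVal.isClosedMap _ isClosed_closure
  · rintro _ ⟨y, -, rfl⟩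
    have hd : Dense (closure (t n))ᶜ := interior_eq_empty_iff_dense_compl.1 (htn n)
    have hy : (y : X) ∈ closure ((↑) '' (closure (t n))ᶜ) :=
      image_closure_subset_closure_image continuous_subtype_val (mem_image_of_mem _ (hd y))
    refine closure_mono ?_ hy
    rintro _ ⟨z, hz, rfl⟩
    refine ⟨z.2, ?_⟩
    rintro ⟨w, hw, hwz⟩
    exact hz (Subtype.ext hwz ▸ hw)
  · rw [MeagerIn, preimage_image_eq _ Subtype.val_injective]
    exact (htn n).closure.isMeagre
  · rintro x ⟨hxA, hxP⟩
    obtain ⟨s, hs, hxs⟩ := hAS (show (⟨x, hxP⟩ : P) ∈ _ from hxA)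
    obtain ⟨n, rfl⟩ : s ∈ range t := ht ▸ mem_insert_of_mem _ hs
    exact mem_iUnion.2 ⟨n, _, subset_closure hxs, rfl⟩

theorem MeagerIn.mono {A B P : Set X} (hAB : A ⊆ B) (hB : MeagerIn B P) : MeagerIn A P :=
  IsMeagre.mono (preimage_mono hAB) hB

theorem meagerIn_singleton [T1Space X] {P : Set X} (hP : Preperfect P) (x : X) :
    MeagerIn {x} P := by
  refine IsNowhereDense.isMeagre (((isClosed_singleton.preimage
    continuous_subtype_val).isNowhereDense_iff).2 ?_)
  rw [eq_empty_iff_forall_notMem]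
  intro y hy
  obtain ⟨V, hV, hVs⟩ := mem_nhds_induced _ _ _ |>.1 (mem_interior_iff_mem_nhds.1 hy)
  obtain ⟨z, ⟨hzV, hzP⟩, hzy⟩ := preperfect_iff_nhds.1 hP y y.2 V hV
  have h1 : z = x := hVs (show (⟨z, hzP⟩ : P) ∈ _ from hzV)
  have h2 : y ∈ ((↑) ⁻¹' {x} : Set P) := interior_subset hy
  exact hzy (h1.trans (mem_singleton_iff.1 h2).symm)

theorem isSigmaIdeal_mgr [T1Space X] {F : Set (Set X)} (hF : ∀ P ∈ F, IsPerfectSet P) :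
    IsSigmaIdeal (MGR F) where
  empty_mem P _ := by simpa [MeagerIn] using IsMeagre.empty
  mono hAB hB P hP := (hB P hP).mono hAB
  iUnion_mem A hA P hP := by
    rw [MeagerIn, preimage_iUnion]
    exact isMeagre_iUnion fun n => hA n P hP
  singleton_mem x P hP := meagerIn_singleton (hF P hP).2.acc x

theorem mgrStar_subset_mgr [T1Space X] {F : Set (Set X)} (hF : ∀ P ∈ F, IsPerfectSet P) :
    MGRStar F ⊆ MGR F :=
  fun _ hA => hA _ ⟨isSigmaIdeal_mgr hF, fun _ hs => hs.2⟩

theorem not_meagerIn_self [PolishSpace X] {P : Set X} (hP : IsPerfectSet P) :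
    ¬ MeagerIn P P := by
  have := hP.2.closed.polishSpace
  have := hP.1.to_subtype
  have h : ((↑) ⁻¹' P : Set P) = univ := by ext x; simp
  rw [MeagerIn, h]
  exact not_isMeagre_of_isOpen isOpen_univ univ_nonempty

theorem mem_mgrStar_singleton [PolishSpace X] {P A : Set X} (hP : IsClosed P)
    (hA : MeagerIn A P) : A ∈ MGRStar {P} := by
  have hI := (isGeneratedByClosed_mgrStar {P}).isSigmaIdeal
  obtain ⟨N, hN, hAN⟩ := hA.exists_closed_cover hP
  -- The complement of P is an F_σ-set whose closed pieces miss P, so it lies in the ideal.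
  let := TopologicalSpace.upgradeIsCompletelyMetrizable X
  obtain ⟨K, hK, hKP, hKU, -⟩ := hP.isOpen_compl.exists_iUnion_isClosed
  have h1 : (⋃ n, N n) ∈ MGRStar {P} := hI.iUnion_mem _ fun n =>
    subset_sigmaIdealGenerated _ ⟨(hN n).1, by rintro _ rfl; exact (hN n).2.2⟩
  have h2 : Pᶜ ∈ MGRStar {P} := by
    rw [← hKU]
    refine hI.iUnion_mem _ fun n => subset_sigmaIdealGenerated _ ⟨hK n, ?_⟩
    intro Q hQ
    rw [mem_singleton_iff.1 hQ]
    have : ((↑) ⁻¹' K n : Set P) = ∅ := by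
      rw [eq_empty_iff_forall_notMem]
      exact fun x hx => hKP n hx x.2
    rw [MeagerIn, this]
    exact IsMeagre.empty
  refine hI.mono (fun x hx => ?_) (hI.union_mem h1 h2)
  by_cases hxP : x ∈ P
  · exact Or.inl (hAN ⟨hx, hxP⟩)
  · exact Or.inr hxP

/-- The countable chain condition for the meager ideal of a Baire second countable space. -/
theorem countable_of_not_isMeagre [SecondCountableTopology X] [BaireSpace X] {ι : Type*}
    (s : ι → Set X) (hs : ∀ i, BaireMeasurableSet (s i)) (hm : ∀ i, ¬ IsMeagre (s i))
    (hd : Pairwise (Function.onFun Disjoint s)) : Countable ι := by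
  have key : ∀ i, ∃ V ∈ TopologicalSpace.countableBasis X, V.Nonempty ∧ IsMeagre (V \ s i) := by
    intro i
    obtain ⟨u, hu, hsu⟩ := (hs i).residualEq_isOpen
    have hd : {x | x ∈ s i ↔ x ∈ u} ∈ residual X := eventuallyEq_set.1 hsu
    have hne : u.Nonempty := by
      rw [nonempty_iff_ne_empty]
      rintro rfl
      refine hm i (mem_of_superset hd fun x hx => ?_)
      simpa using hx
    obtain ⟨x, hx⟩ := hne
    obtain ⟨V, hV, hxV, hVu⟩ :=
      (TopologicalSpace.isBasis_countableBasis X).exists_subset_of_mem_open hx hu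
    refine ⟨V, hV, ⟨x, hxV⟩, mem_of_superset hd fun y hy hyV => hyV.2 (hy.2 (hVu hyV.1))⟩
  choose V hVb hVne hVm using key
  have := (TopologicalSpace.countable_countableBasis X).to_subtype
  refine Function.Injective.countable (f := fun i => (⟨V i, hVb i⟩ :
    TopologicalSpace.countableBasis X)) fun i j hij => ?_
  by_contra hne
  have hV : V i = V j := congrArg Subtype.val hij
  -- Two disjoint sets comeager in the same basic open set would make that set meager.
  refine not_isMeagre_of_isOpen (TopologicalSpace.isOpen_of_mem_countableBasis (hVb i)) (hVne i)
    (((hVm i).union (hVm j)).mono fun x hx => ?_)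
  by_cases hxi : x ∈ s i
  · exact Or.inr ⟨hV ▸ hx, fun hxj => disjoint_left.1 (hd hne) hxi hxj⟩
  · exact Or.inl ⟨hx, hxi⟩

theorem ccc_mgrStar_singleton [PolishSpace X] {P : Set X} (hP : IsClosed P) :
    CCC (MGRStar {P}) := by
  intro D hD hdisj
  have := hP.polishSpace
  borelize X
  refine countable_of_not_isMeagre (fun i : D => ((↑) ⁻¹' (i : Set X) : Set P)) ?_ ?_ ?_
  · intro i
    exact (measurable_subtype_coe (hD i i.2).1).baireMeasurableSet
  · exact fun i hi => (hD i i.2).2 (mem_mgrStar_singleton hP hi)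
  · intro i j hij
    exact (hdisj i.2 j.2 fun h => hij (Subtype.ext h)).preimage _

theorem mem_mgrStar_of_mem_pmσ {A : Set X} (hA : A ∈ PMσ X) {F : Set (Set X)}
    (hF : IsPerfectFamily F) : A ∈ MGRStar F := by
  obtain ⟨P, rfl⟩ := hF.countable.exists_eq_range hF.nonempty
  obtain ⟨_, ⟨K, hK, rfl⟩, hAK, hm⟩ := hA P fun n => hF.perfect _ ⟨n, rfl⟩
  have hσ := (isGeneratedByClosed_mgrStar (range P)).isSigmaIdeal
  refine hσ.mono hAK (hσ.iUnion_mem _ fun n => subset_sigmaIdealGenerated _ ⟨hK n, ?_⟩)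
  rintro _ ⟨m, rfl⟩
  exact (hm m).mono (subset_iUnion K n)

theorem isPerfectFamily_singleton {P : Set X} (hP : IsPerfectSet P) : IsPerfectFamily {P} :=
  ⟨countable_singleton P, singleton_nonempty P, by rintro _ rfl; exact hP⟩

end Topological

/-! ### A criterion for the failure of the countable chain condition -/

section Annuli

variable {X : Type*} [PseudoMetricSpace X]

open Metric

theorem exists_open_in_annulus {C N : Set X} (hN : IsClosed N) (hNC : N ⊆ closure (C \ N))
    {q : X} (hq : q ∈ N) {r d : ℝ} (hr : 0 < r) (hd : 0 < d) :
    ∃ d' > 0, d' < d ∧ ∃ W : Set X, IsOpen W ∧ (W ∩ C).Nonempty ∧ W ⊆ ball q r ∧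
      ∀ x ∈ W, d' < infDist x N ∧ infDist x N < d := by
  obtain ⟨y, ⟨hyC, hyN⟩, hy⟩ := Metric.mem_closure_iff.1 (hNC hq) (min r d) (lt_min hr hd)
  have hpos : 0 < infDist y N := (hN.notMem_iff_infDist_pos ⟨q, hq⟩).1 hyN
  rw [dist_comm] at hy
  have hlt : infDist y N < d :=
    (infDist_le_dist_of_mem hq).trans_lt (hy.trans_le (min_le_right _ _))
  refine ⟨infDist y N / 2, half_pos hpos, by linarith,
    ball q r ∩ {x | infDist y N / 2 < infDist x N ∧ infDist x N < d}, ?_, ?_,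
    inter_subset_left, fun x hx => hx.2⟩
  · exact isOpen_ball.inter ((isOpen_lt continuous_const (continuous_infDist_pt N)).inter
      (isOpen_lt (continuous_infDist_pt N) continuous_const))
  · exact ⟨y, ⟨hy.trans_le (min_le_left _ _), by linarith, hlt⟩, hyC⟩

/-- Given a closed set `N` that is nowhere dense in `C` there are two sequences of pairwise disjoint
small open sets meeting `C`, each of which accumulates at every point of `N`. -/
theorem exists_disjoint_open_accumulating [TopologicalSpace.SeparableSpace X] {C N U : Set X}
    (hN : IsClosed N) (hNC : N ⊆ closure (C \ N)) (hne : N.Nonempty) (hU : IsOpen U) (hNU : N ⊆ U)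
    {ε : ℝ} (hε : 0 < ε) :
    ∃ W : Bool × ℕ → Set X, (∀ p, IsOpen (W p) ∧ (W p ∩ C).Nonempty ∧ closure (W p) ⊆ U ∧
        ∀ x ∈ W p, ∀ y ∈ W p, dist x y ≤ ε) ∧
      (∀ p p', (W p ∩ W p').Nonempty → p = p') ∧
      ∀ q ∈ N, ∀ V, IsOpen V → q ∈ V → ∀ b, ∃ j, W (b, j) ⊆ V := by
  have := hne.to_subtype
  have : TopologicalSpace.SeparableSpace N :=
    (TopologicalSpace.IsSeparable.of_separableSpace N).separableSpace
  -- Each index codes a label, a point of a dense sequence in N and a scale, so each label is served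
  -- near each point at each scale.
  obtain ⟨e⟩ : Nonempty (ℕ ≃ Bool × ℕ) := nonempty_equiv_of_countable
  let q : ℕ → N := fun n => TopologicalSpace.denseSeq N (e n).2.unpair.1
  let k : ℕ → ℕ := fun n => (e n).2.unpair.2
  have hρ : ∀ n, ∃ r > 0, closedBall (q n : X) r ⊆ U ∧ 2 * r ≤ ε ∧ r ≤ 1 / ((k n : ℝ) + 1) := by
    intro n
    obtain ⟨r, hr, hrU⟩ := Metric.nhds_basis_closedBall.mem_iff.1 (hU.mem_nhds (hNU (q n).2))
    refine ⟨min r (min (ε / 2) (1 / ((k n : ℝ) + 1))), by positivity,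
      (closedBall_subset_closedBall (min_le_left _ _)).trans hrU, ?_, ?_⟩
    · have : min r (min (ε / 2) (1 / ((k n : ℝ) + 1))) ≤ ε / 2 :=
        (min_le_right _ _).trans (min_le_left _ _)
      linarith
    · exact (min_le_right _ _).trans (min_le_right _ _)
  choose r hr hrU hrε hrk using hρ
  have step : ∀ (n : ℕ) (d : {d : ℝ // 0 < d}), ∃ d' : {d : ℝ // 0 < d}, d'.1 < d.1 ∧
      ∃ W : Set X, IsOpen W ∧ (W ∩ C).Nonempty ∧ W ⊆ ball (q n : X) (r n) ∧
        ∀ x ∈ W, d'.1 < infDist x N ∧ infDist x N < d.1 := by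
    intro n d
    obtain ⟨d', hd', hlt, h⟩ := exists_open_in_annulus hN hNC (q n).2 (hr n) d.2
    exact ⟨⟨d', hd'⟩, hlt, h⟩
  choose next hnext W hWo hWC hWb hWd using step
  -- The n-th open set lies in the annulus of points at distance between `d (n + 1)` and `d n` from
  -- N; these annuli are disjoint.
  let d : ℕ → {d : ℝ // 0 < d} := fun n => Nat.rec ⟨1, one_pos⟩ (fun n d => next n d) n
  have hanti : Antitone fun n => (d n).1 := antitone_nat_of_succ_le fun n => (hnext n (d n)).le
  have hdisj : ∀ m n, m < n → ∀ x ∈ W m (d m), x ∉ W n (d n) := by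
    intro m n hmn x hxm hxn
    have h1 : (d (m + 1)).1 < infDist x N := (hWd m (d m) x hxm).1
    have h2 := (hWd n (d n) x hxn).2
    have h3 : (d n).1 ≤ (d (m + 1)).1 := hanti hmn
    linarith
  refine ⟨fun p => W (e.symm p) (d (e.symm p)), fun p => ⟨hWo _ _, hWC _ _, ?_, ?_⟩, ?_, ?_⟩
  · exact (closure_mono (hWb _ _)).trans (closure_ball_subset_closedBall.trans (hrU _))
  · intro x hx y hy
    have h1 := mem_ball.1 (hWb _ _ hx)
    have h2 := mem_ball.1 (hWb _ _ hy)
    have h3 := hrε (e.symm p)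
    have h4 := dist_triangle_right x y (q (e.symm p) : X)
    linarith
  · rintro p p' ⟨x, hx, hx'⟩
    rcases lt_trichotomy (e.symm p) (e.symm p') with h | h | h
    · exact (hdisj _ _ h x hx hx').elim
    · exact e.symm.injective h
    · exact (hdisj _ _ h x hx' hx).elim
  · intro z hz V hV hzV b
    obtain ⟨s, hs, hsV⟩ := Metric.isOpen_iff.1 hV z hzV
    obtain ⟨i, hi⟩ := (TopologicalSpace.denseRange_denseSeq N).exists_dist_lt ⟨z, hz⟩ (half_pos hs)
    obtain ⟨m, hm⟩ := exists_nat_one_div_lt (half_pos hs)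
    refine ⟨Nat.pair i m, fun x hx => hsV ?_⟩
    have h1 := mem_ball.1 (hWb _ _ hx)
    have h2 := hrk (e.symm (b, Nat.pair i m))
    have hq : q (e.symm (b, Nat.pair i m)) = TopologicalSpace.denseSeq N i := by simp [q]
    have hk : k (e.symm (b, Nat.pair i m)) = m := by simp [k]
    rw [hq] at h1
    rw [hk] at h2
    have hi' : dist z (TopologicalSpace.denseSeq N i : X) < s / 2 := hi
    rw [mem_ball]
    have h4 := dist_triangle_right x z (TopologicalSpace.denseSeq N i : X)
    linarith

end Annuli

/-- The nodes at height `n` of the tree with root `u₀` and successors `W u n`, along the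
sequence `α` of labels. -/
def treeLevel {T : Type*} (W : T → ℕ → Bool × ℕ → T) (u₀ : T) (α : ℕ → Bool) : ℕ → Set T
  | 0 => {u₀}
  | n + 1 => {v | ∃ u ∈ treeLevel W u₀ α n, ∃ j, v = W u n (α n, j)}

/-- Siblings are disjoint and children lie inside parents, so a point determines its node at each
height, hence the labels leading there. -/
theorem eq_of_mem_treeLevel {T X : Type*} {S : T → Set X} {W : T → ℕ → Bool × ℕ → T} {u₀ : T}
    (hsub : ∀ u n p, S (W u n p) ⊆ S u)
    (hdisj : ∀ u n p p', (S (W u n p) ∩ S (W u n p')).Nonempty → p = p') {α β : ℕ → Bool} {x : X}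
    (n : ℕ) : ∀ u ∈ treeLevel W u₀ α n, ∀ v ∈ treeLevel W u₀ β n, x ∈ S u → x ∈ S v →
      u = v ∧ ∀ k < n, α k = β k := by
  induction n with
  | zero =>
    rintro u rfl v rfl - -
    exact ⟨rfl, by simp⟩
  | succ n ih =>
    rintro _ ⟨u, hu, i, rfl⟩ _ ⟨v, hv, j, rfl⟩ hxu hxv
    obtain ⟨rfl, hk⟩ := ih u hu v hv (hsub _ _ _ hxu) (hsub _ _ _ hxv)
    have hp := hdisj _ _ _ _ ⟨x, hxu, hxv⟩
    refine ⟨by rw [hp], fun k hkn => ?_⟩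
    rcases Nat.lt_succ_iff_lt_or_eq.1 hkn with h | rfl
    · exact hk k h
    · exact congrArg Prod.fst hp

theorem exists_mem_iInter_of_nested {X : Type*} [MetricSpace X] [CompleteSpace X] {u : ℕ → Set X}
    (hne : ∀ n, (u n).Nonempty) (hcl : ∀ n, closure (u (n + 1)) ⊆ u n)
    -- The bound starts at `u 1`, since the root will be the whole space.
    (hd : ∀ n, ∀ x ∈ u (n + 1), ∀ y ∈ u (n + 1), dist x y ≤ (1 / 2 : ℝ) ^ n) :
    ∃ x, ∀ n, x ∈ u n := by
  choose x hx using hne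
  have hanti : Antitone u := antitone_nat_of_succ_le fun n => subset_closure.trans (hcl n)
  have hcau : CauchySeq fun n => x (n + 1) := by
    refine cauchySeq_of_le_geometric (1 / 2) 1 (by norm_num) fun n => ?_
    rw [one_mul]
    exact hd n _ (hx _) _ (hanti (Nat.le_succ _) (hx _))
  obtain ⟨z, hz⟩ := cauchySeq_tendsto_of_complete hcau
  refine ⟨z, fun n => hcl n (mem_closure_of_tendsto hz ?_)⟩
  filter_upwards [eventually_ge_atTop n] with m hm
  exact hanti (Nat.succ_le_succ hm) (hx _)

section Main

variable {X : Type*} [TopologicalSpace X] [PolishSpace X]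

theorem not_ccc_of_closed_nowhereDense {I : Set (Set X)} (hI : IsGeneratedByClosed I) {C : Set X}
    (hC : C.Nonempty) (h : ∀ U, IsOpen U → (U ∩ C).Nonempty →
      ∃ N ⊆ U, IsClosed N ∧ N ∉ I ∧ N ⊆ closure (C \ N)) : ¬ CCC I := by
  have hσ := hI.isSigmaIdeal
  let := TopologicalSpace.upgradeIsCompletelyMetrizable X
  let T := {U : Set X // IsOpen U ∧ (U ∩ C).Nonempty}
  have child : ∀ (u : T) (n : ℕ), ∃ N : Set X, N ∉ I ∧ ∃ W : Bool × ℕ → T,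
      (∀ p, closure (W p).1 ⊆ u.1 ∧ ∀ x ∈ (W p).1, ∀ y ∈ (W p).1, dist x y ≤ (1 / 2 : ℝ) ^ n) ∧
      (∀ p p', ((W p).1 ∩ (W p').1).Nonempty → p = p') ∧
      ∀ q ∈ N, ∀ V, IsOpen V → q ∈ V → ∀ b, ∃ j, (W (b, j)).1 ⊆ V := by
    intro u n
    obtain ⟨N, hNU, hNc, hNI, hNC⟩ := h u.1 u.2.1 u.2.2
    obtain ⟨W, hW, hWd, hWN⟩ := exists_disjoint_open_accumulating hNc hNC
      (hσ.nonempty_of_notMem hNI) u.2.1 hNU (ε := (1 / 2 : ℝ) ^ n) (by positivity)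
    exact ⟨N, hNI, fun p => ⟨W p, (hW p).1, (hW p).2.1⟩, fun p => (hW p).2.2, hWd, hWN⟩
  choose N hNI W hW hWd hWN using child
  let u₀ : T := ⟨univ, isOpen_univ, by simpa using hC⟩
  let G : (ℕ → Bool) → Set X := fun α => ⋂ n, ⋃ u ∈ treeLevel W u₀ α n, u.1
  have hmem : ∀ α x, x ∈ G α ↔ ∀ n, ∃ u ∈ treeLevel W u₀ α n, x ∈ u.1 := by
    intro α x
    simp only [G, mem_iInter, mem_iUnion, exists_prop]
  have hGdisj : ∀ α β x, x ∈ G α → x ∈ G β → α = β := by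
    intro α β x hα hβ
    funext k
    obtain ⟨u, hu, hxu⟩ := (hmem α x).1 hα (k + 1)
    obtain ⟨v, hv, hxv⟩ := (hmem β x).1 hβ (k + 1)
    exact (eq_of_mem_treeLevel (S := fun u : T => u.1)
      (fun u n p => subset_closure.trans (hW u n p).1) hWd (k + 1) u hu v hv hxu hxv).2 k
      (Nat.lt_succ_self k)
  have hGm : ∀ α, @MeasurableSet X (borel X) (G α) := by
    intro α
    borelize X
    exact MeasurableSet.iInter fun n => (isOpen_biUnion fun u _ => u.2.1).measurableSet
  have hGI : ∀ α, G α ∉ I := by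
    intro α hα
    obtain ⟨D, hD, hGD⟩ := hI.exists_closed_cover hα
    have step : ∀ (n : ℕ) (u : T), ∃ j, (W u n (α n, j)).1 ⊆ (D n)ᶜ := by
      intro n u
      -- N is not in I but `D n` is, so N leaves `D n`; a child with the prescribed label then fits
      -- in its complement.
      obtain ⟨q, hqN, hqD⟩ := not_subset.1 fun hsub => hNI u n (hσ.mono hsub (hD n).2)
      exact hWN u n q hqN _ (hD n).1.isOpen_compl hqD (α n)
    choose j hj using step
    let u : ℕ → T := fun n => Nat.rec u₀ (fun n v => W v n (α n, j n v)) n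
    have hu : ∀ n, u n ∈ treeLevel W u₀ α n := by
      intro n
      induction n with
      | zero => rfl
      | succ n ih => exact ⟨u n, ih, j n (u n), rfl⟩
    obtain ⟨x, hx⟩ := exists_mem_iInter_of_nested (u := fun n => (u n).1)
      (fun n => (u n).2.2.mono inter_subset_left) (fun n => (hW (u n) n _).1)
      (fun n => (hW (u n) n _).2)
    obtain ⟨n, hn⟩ := mem_iUnion.1 (hGD ((hmem α x).2 fun n => ⟨u n, hu n, hx n⟩))
    exact hj n (u n) (hx (n + 1)) hn
  intro hccc
  have hinj : Function.Injective G := by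
    intro α β hαβ
    obtain ⟨x, hx⟩ := hσ.nonempty_of_notMem (hGI α)
    exact hGdisj α β x hx (hαβ ▸ hx)
  have hcount : (range G).Countable := by
    refine hccc _ ?_ ?_
    · rintro _ ⟨α, rfl⟩
      exact ⟨hGm α, hGI α⟩
    · rintro _ ⟨α, rfl⟩ _ ⟨β, rfl⟩ hne
      exact disjoint_left.2 fun x hx hx' => hne (congrArg G (hGdisj α β x hx hx'))
  have hc : Countable (ℕ → Bool) := by
    have := hcount.preimage_of_injOn hinj.injOn
    rw [preimage_range] at this
    exact countable_univ_iff.1 this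
  obtain ⟨f, hf⟩ := exists_surjective_nat (ℕ → Bool)
  obtain ⟨n, hn⟩ := hf fun k => !f k k
  simpa using congrFun hn n

theorem not_ccc_mgrStar {F : Set (Set X)} (hF : IsPerfectFamily F)
    (h : ∀ U : Set X, IsOpen U → U.Nonempty → ∃ P ∈ F, P ⊆ U ∧ IsNowhereDense P) :
    ¬ CCC (MGRStar F) := by
  obtain ⟨Q, hQ⟩ := hF.nonempty
  refine not_ccc_of_closed_nowhereDense (isGeneratedByClosed_mgrStar F) (C := univ)
    ((hF.perfect Q hQ).1.mono (subset_univ _)) fun U hU hne => ?_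
  obtain ⟨P, hP, hPU, hPn⟩ := h U hU (by simpa using hne)
  have hPc := (hF.perfect P hP).2.closed
  refine ⟨P, hPU, hPc, fun hPI => not_meagerIn_self (hF.perfect P hP)
    (mgrStar_subset_mgr hF.perfect hPI P hP), ?_⟩
  rw [← compl_eq_univ_sdiff, (interior_eq_empty_iff_dense_compl.1
    (hPc.isNowhereDense_iff.1 hPn)).closure_eq]
  exact subset_univ _

/-! ### Perfectly meager sets and c.c.c. ideals -/

theorem mem_of_mem_pm_of_ccc {I : Set (Set X)} (hI : IsGeneratedByClosed I) (hccc : CCC I)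
    {A : Set X} (hA : A ∈ PM X) : A ∈ I := by
  by_contra hAI
  have hσ := hI.isSigmaIdeal
  have hb := TopologicalSpace.isBasis_countableBasis X
  let S : Set (Set X) := {V ∈ TopologicalSpace.countableBasis X | A ∩ V ∈ I}
  have hAS : A ∩ ⋃₀ S ∈ I := by
    rw [sUnion_eq_biUnion, inter_iUnion₂, ← sUnion_image]
    refine hσ.sUnion_mem (((TopologicalSpace.countable_countableBasis X).mono
      (sep_subset _ _)).image _) ?_
    rintro _ ⟨V, hV, rfl⟩
    exact hV.2
  -- A is positive on every open set meeting C, so C is non-empty and has no isolated points.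
  let C : Set X := (⋃₀ S)ᶜ
  have hCc : IsClosed C := (isOpen_sUnion fun V hV =>
    TopologicalSpace.isOpen_of_mem_countableBasis hV.1).isClosed_compl
  have hpos : ∀ V, IsOpen V → (V ∩ C).Nonempty → A ∩ C ∩ V ∉ I := by
    rintro V hV ⟨x, hxV, hxC⟩ hmem
    obtain ⟨B, hB, hxB, hBV⟩ := hb.exists_subset_of_mem_open hxV hV
    refine hxC ⟨B, ⟨hB, hσ.mono ?_ (hσ.union_mem hAS hmem)⟩, hxB⟩
    rintro y ⟨hyA, hyB⟩
    by_cases hy : y ∈ ⋃₀ S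
    · exact Or.inl ⟨hyA, hy⟩
    · exact Or.inr ⟨⟨hyA, hy⟩, hBV hyB⟩
  have hCne : C.Nonempty := by
    rw [nonempty_iff_ne_empty]
    intro hC
    rw [compl_empty_iff.1 hC, inter_univ] at hAS
    exact hAI hAS
  have hCp : IsPerfectSet C := by
    refine ⟨hCne, hCc, preperfect_iff_nhds.2 fun x hx U hU => ?_⟩
    by_contra! hcon
    obtain ⟨V, hVU, hV, hxV⟩ := mem_nhds_iff.1 hU
    exact hpos V hV ⟨x, hxV, hx⟩ (hσ.mono (fun y hy => hcon y ⟨hVU hy.2, hy.1.2⟩)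
      (hσ.singleton_mem x))
  obtain ⟨N, hN, hAN⟩ := (hA C hCp).exists_closed_cover hCc
  refine not_ccc_of_closed_nowhereDense hI hCne ?_ hccc
  rintro U hU ⟨x, hxU, hxC⟩
  let := TopologicalSpace.upgradeIsCompletelyMetrizable X
  obtain ⟨K, hK, hKc, hKU⟩ := exists_mem_nhds_isClosed_subset (hU.mem_nhds hxU)
  have hnot : ∃ n, N n ∩ K ∉ I := by
    by_contra! hall
    refine hpos (interior K) isOpen_interior ⟨x, mem_interior_iff_mem_nhds.2 hK, hxC⟩
      (hσ.mono ?_ (hσ.iUnion_mem _ hall))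
    rintro y ⟨hyA, hyK⟩
    obtain ⟨n, hn⟩ := mem_iUnion.1 (hAN hyA)
    exact mem_iUnion.2 ⟨n, hn, interior_subset hyK⟩
  obtain ⟨n, hn⟩ := hnot
  -- Shrinking `N n` only enlarges its complement in C.
  exact ⟨N n ∩ K, inter_subset_right.trans hKU, (hN n).1.inter hKc, hn,
    inter_subset_left.trans ((hN n).2.1.trans (closure_mono (sdiff_subset_sdiff_right
      inter_subset_left)))⟩

/-! ### Nowhere dense perfect sets -/

theorem tendsto_update_nhds (a : ℕ → Bool) (k : ℕ → ℕ) (hk : ∀ n, n ≤ k n) (c : ℕ → Bool) :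
    Tendsto (fun n => Function.update a (k n) (c n)) atTop (𝓝 a) := by
  refine tendsto_pi_nhds.2 fun i => tendsto_const_nhds.congr' ?_
  filter_upwards [eventually_gt_atTop i] with n hn
  rw [Function.update_of_ne (hn.trans_le (hk n)).ne]

theorem isPerfectSet_range {f : (ℕ → Bool) → X} (hf : Continuous f) (hinj : Function.Injective f) :
    IsPerfectSet (range f) := by
  refine ⟨range_nonempty f, (isCompact_range hf).isClosed, preperfect_iff_nhds.2 ?_⟩
  rintro _ ⟨a, rfl⟩ U hU
  obtain ⟨n, hn⟩ := ((hf.continuousAt.tendsto.comp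
    (tendsto_update_nhds a id (fun _ => le_rfl) fun n => !a n)).eventually hU).exists
  refine ⟨_, ⟨hn, mem_range_self _⟩, fun heq => ?_⟩
  have := congrFun (hinj heq) n
  simp at this

theorem exists_isPerfectSet_isNowhereDense_subset [PerfectSpace X] {U : Set X} (hU : IsOpen U)
    (hne : U.Nonempty) : ∃ P, IsPerfectSet P ∧ P ⊆ U ∧ IsNowhereDense P := by
  obtain ⟨x, hx⟩ := hne
  let := TopologicalSpace.upgradeIsCompletelyMetrizable X
  obtain ⟨K, hK, hKc, hKU⟩ := exists_mem_nhds_isClosed_subset (hU.mem_nhds hx)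
  have hp : Perfect (closure (interior K)) := isOpen_interior.perfect_closure
  obtain ⟨f, hfr, hf, hfi⟩ := hp.exists_nat_bool_injection
    ⟨x, subset_closure (mem_interior_iff_mem_nhds.2 hK)⟩
  -- A copy of Cantor space with all odd coordinates false: setting a far odd coordinate to true
  -- leaves it by an arbitrarily small move.
  let g : (ℕ → Bool) → ℕ → Bool := fun a n => if Even n then a (n / 2) else false
  have hg : Continuous g := continuous_pi fun n => by
    by_cases hn : Even n
    · simpa [g, hn] using continuous_apply (n / 2)
    · simpa [g, hn] using continuous_const
  have hgi : Function.Injective g := by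
    intro a b hab
    funext n
    simpa [g] using congrFun hab (2 * n)
  have hP := isPerfectSet_range (hf.comp hg) (hfi.comp hgi)
  refine ⟨range (f ∘ g), hP, ?_, ?_⟩
  · exact (range_comp_subset_range g f).trans (hfr.trans
      ((closure_minimal interior_subset hKc).trans hKU))
  · rw [hP.2.closed.isNowhereDense_iff, eq_empty_iff_forall_notMem]
    intro y hy
    obtain ⟨a, rfl⟩ := interior_subset hy
    obtain ⟨n, hn⟩ := ((hf.continuousAt.tendsto.comp (tendsto_update_nhds (g a)
      (fun n => 2 * n + 1) (fun n => by omega) fun _ => true)).eventually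
      (isOpen_interior.mem_nhds hy)).exists
    obtain ⟨b, hb⟩ := interior_subset hn
    have := congrFun (hfi hb) (2 * n + 1)
    simp [g] at this

/-- One nowhere dense perfect subset of each non-empty basic open set is added to the sequence. -/
theorem exists_isPerfectFamily_not_ccc [PerfectSpace X] {P : ℕ → Set X}
    (hP : ∀ n, IsPerfectSet (P n)) :
    ∃ F : Set (Set X), IsPerfectFamily F ∧ (∀ n, P n ∈ F) ∧ ¬ CCC (MGRStar F) := by
  have hQ : ∀ V : Set X, ∃ Q, IsPerfectSet Q ∧
      (IsOpen V → V.Nonempty → Q ⊆ V ∧ IsNowhereDense Q) := by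
    intro V
    by_cases hV : IsOpen V ∧ V.Nonempty
    · obtain ⟨Q, hQ, h⟩ := exists_isPerfectSet_isNowhereDense_subset hV.1 hV.2
      exact ⟨Q, hQ, fun _ _ => h⟩
    -- `P 0` is a dummy value.
    · exact ⟨P 0, hP 0, fun h1 h2 => (hV ⟨h1, h2⟩).elim⟩
  choose Q hQp hQV using hQ
  have hF : IsPerfectFamily (range P ∪ Q '' TopologicalSpace.countableBasis X) := by
    refine ⟨(countable_range P).union
      ((TopologicalSpace.countable_countableBasis X).image Q), ⟨P 0, Or.inl ⟨0, rfl⟩⟩, ?_⟩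
    rintro _ (⟨n, rfl⟩ | ⟨V, -, rfl⟩)
    · exact hP n
    · exact hQp V
  refine ⟨_, hF, fun n => Or.inl ⟨n, rfl⟩, not_ccc_mgrStar hF ?_⟩
  rintro U hU ⟨x, hx⟩
  obtain ⟨V, hV, hxV, hVU⟩ :=
    (TopologicalSpace.isBasis_countableBasis X).exists_subset_of_mem_open hx hU
  have h := hQV V (TopologicalSpace.isOpen_of_mem_countableBasis hV) ⟨x, hxV⟩
  exact ⟨Q V, Or.inr ⟨V, hV, rfl⟩, h.1.trans hVU, h.2⟩

theorem mem_pmσ_of_forall_mem_mgrStar [PerfectSpace X] {A : Set X}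
    (hA : ∀ F : Set (Set X), IsPerfectFamily F → ¬ CCC (MGRStar F) → A ∈ MGRStar F) :
    A ∈ PMσ X := by
  intro P hP
  obtain ⟨F, hF, hPF, hccc⟩ := exists_isPerfectFamily_not_ccc hP
  obtain ⟨D, hD, hAD⟩ := (isGeneratedByClosed_mgrStar F).exists_closed_cover (hA F hF hccc)
  refine ⟨_, ⟨D, fun n => (hD n).1, rfl⟩, hAD, fun n => ?_⟩
  exact (isSigmaIdeal_mgr hF.perfect).iUnion_mem D
    (fun m => mgrStar_subset_mgr hF.perfect (hD m).2) (P n) (hPF n)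

end Main

end PerfMeager

theorem mainTheorem11 {X : Type*} [TopologicalSpace X] [PolishSpace X] [PerfectSpace X] :
    (∀ F : Set (Set X), PerfMeager.IsPerfectFamily F →
      (∀ U : Set X, IsOpen U → U.Nonempty → ∃ P ∈ F, P ⊆ U ∧ IsNowhereDense P) →
      ¬ PerfMeager.CCC (PerfMeager.MGRStar F)) ∧
    (⋂₀ {I : Set (Set X) | PerfMeager.IsGeneratedByClosed I ∧ PerfMeager.CCC I}
      = PerfMeager.PM X) ∧
    (⋂₀ {I : Set (Set X) | ∃ F : Set (Set X), PerfMeager.IsPerfectFamily F ∧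
        I = PerfMeager.MGRStar F ∧ PerfMeager.CCC I}
      = PerfMeager.PM X) ∧
    (⋂₀ {I : Set (Set X) | ∃ F : Set (Set X), PerfMeager.IsPerfectFamily F ∧
        I = PerfMeager.MGRStar F ∧ ¬ PerfMeager.CCC I}
      = PerfMeager.PMσ X) := by
  open PerfMeager in
  refine ⟨fun F hF h => not_ccc_mgrStar hF h, ?_, ?_, ?_⟩
  · refine Subset.antisymm (fun A hA P hP => ?_) fun A hA I hI =>
      mem_of_mem_pm_of_ccc hI.1 hI.2 hA
    have hF := isPerfectFamily_singleton hP
    exact mgrStar_subset_mgr hF.perfect (hA _ ⟨isGeneratedByClosed_mgrStar {P},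
      ccc_mgrStar_singleton hP.2.closed⟩) P rfl
  · refine Subset.antisymm (fun A hA P hP => ?_) ?_
    · have hF := isPerfectFamily_singleton hP
      exact mgrStar_subset_mgr hF.perfect
        (hA _ ⟨{P}, hF, rfl, ccc_mgrStar_singleton hP.2.closed⟩) P rfl
    · rintro A hA _ ⟨F, -, rfl, hccc⟩
      exact mem_of_mem_pm_of_ccc (isGeneratedByClosed_mgrStar F) hccc hA
  · refine Subset.antisymm (fun A hA => ?_) ?_
    · exact mem_pmσ_of_forall_mem_mgrStar fun F hF hccc => hA _ ⟨F, hF, rfl, hccc⟩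
    · rintro A hA _ ⟨F, hF, rfl, -⟩
      exact mem_mgrStar_of_mem_pmσ hA hF
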